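/- Define real numbers $u_{n,k}$ and $v_n$ recursively by $u_{1,1}=1$, $u_{1,k}=0$ for $k\ne1$, $v_0=-1$, and, for $n\ge 2$, $$v_{n-1}=\frac12\sum_{m=1}^{n-1}\ \sum_{l=1}^{\min(m,n-m-1)}u_{m,l}\,u_{n-m,1+l},$$ $$(1-k)u_{n,k}+k\sum_{m=1}^{n-k} v_{m}u_{n-m,k}-\frac{k}{4}\sum_{m=1}^{n-1}\ \sum_{l=\max(1,k-n+m)}^{\min(m,k-1)}u_{m,l}u_{n-m,k-l}-\frac{k}{2}\sum_{m=1}^{n-1}\ \sum_{l=1}^{\min(m,n-m-k)}u_{m,l}u_{n-m,k+l}=0\qquad(2\le k\le n),$$ with $u_{n,k}=0$ for $k\notin[2,n]$, where empty sums are $0$. Put $u_n(x)=\sum_{k} u_{n,k}\cos(kx)$, so that $u_1=\cos$. Let $B=\sqrt{\pi^2/3+869/144}$ and let $x^*$ be the largest $x\ge0$ with $$8x+\sqrt{17}\,x^2-4\le-2\sqrt{(2Bx^2+4x)\left(x\sqrt{x^2+5/2}+\tfrac52\sinh^{-1}\!\big(\sqrt{2/5}\,x\big)\right)}.$$ Theorem.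 One has $x^*\approx0.23$ (precisely, $|x^*-0.23|<0.005$). For every $\varepsilon\in\mathbb C$ with $|\varepsilon|<x^*$ the power series $$u_\varepsilon=\sum_{n\ge1}u_n\varepsilon^n,\qquad v_\varepsilon=\sum_{n\ge0}v_n\varepsilon^n$$ converge absolutely, the first in $H^1(\mathbb T)$, $\mathbb T=\mathbb R/2\pi\mathbb Z$ (and pointwise), the second in $\mathbb C$; and their sums solve the traveling wave equation of the Burgers–Hilbert equation $f_t=Hf+ff_x$, $$Hu_\varepsilon-v_\varepsilon u_\varepsilon'+u_\varepsilon u_\varepsilon'=0\quad\text{a.e. on }\mathbb T,$$ where $u_\varepsilon'$ is the weak derivative and $H$ is the Hilbert transform, $\widehat{Hf}(k)=-i\,\mathrm{sgn}(k)\hat f(k)$. -/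

import Mathlib

open MeasureTheory Filter Topology

noncomputable section

namespace BurgersHilbert

/-! ### The coefficients of the formal expansion
`u_ε(x) = ∑_{n ≥ 1} u_n(x) ε^n`, `v_ε = ∑_{n ≥ 0} v_n ε^n`,
`u_1 = cos x`, `v_0 = -1`, `u_n = ∑_{k=2}^n u_{n,k} cos (k x)` for `n ≥ 2`. -/

/-- The value of `v_{n-1}` in terms of the `u_{m,l}` with `m < n`. -/
def vNext (n : ℕ) (u : ℕ → ℕ → ℝ) : ℝ :=
  (1 / 2) * ∑ m ∈ Finset.Icc 1 (n - 1), ∑ l ∈ Finset.Icc 1 (min m (n - m - 1)),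
    u m l * u (n - m) (1 + l)

/-- The value of `u_{n,k}` in terms of the `u_{m,l}` with `m < n` and the `v_m` with `m ≤ n - 2`.
The truncated subtractions give the intended (possibly empty) ranges of summation. -/
def uNext (n : ℕ) (u : ℕ → ℕ → ℝ) (v : ℕ → ℝ) (k : ℕ) : ℝ :=
  if 2 ≤ k ∧ k ≤ n then
    (1 / ((k : ℝ) - 1)) *
      (k * ∑ m ∈ Finset.Icc 1 (n - k), v m * u (n - m) k
        - (k / 4) * ∑ m ∈ Finset.Icc 1 (n - 1),
            ∑ l ∈ Finset.Icc (max 1 (k + m - n)) (min m (k - 1)), u m l * u (n - m) (k - l)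
        - (k / 2) * ∑ m ∈ Finset.Icc 1 (n - 1),
            ∑ l ∈ Finset.Icc 1 (min m (n - m - k)), u m l * u (n - m) (k + l))
  else 0

/-- `waveCoeff n = ((u_{n,k})_k, v_{n-1})` for `n ≥ 1`, by recursion on `n`. -/
def waveCoeff : ℕ → (ℕ → ℝ) × ℝ
  | 0 => 0
  | 1 => (Pi.single 1 1, -1)
  | n + 2 =>
    let p : ℕ → (ℕ → ℝ) × ℝ := fun m => if _h : m < n + 2 then waveCoeff m else 0
    (uNext (n + 2) (fun m => (p m).1) (fun m => (p (m + 1)).2), vNext (n + 2) (fun m => (p m).1))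
  termination_by n => n

/-- `u_{n,k}`. -/
def uCoeff (n k : ℕ) : ℝ := (waveCoeff n).1 k

/-- `v_n`. -/
def vCoeff (n : ℕ) : ℝ := (waveCoeff (n + 1)).2

/-- The trigonometric polynomial `u_n(x) = ∑_k u_{n,k} cos (k x)`; here `u_0 = 0`, `u_1 = cos`. -/
def uTerm (n : ℕ) (x : ℝ) : ℝ := ∑ k ∈ Finset.range (n + 1), uCoeff n k * Real.cos (k * x)

/-! The recurrence relations, as a check of the definition. -/

theorem uCoeff_one : uCoeff 1 = Pi.single 1 1 := by
  funext k; simp [uCoeff, waveCoeff]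

theorem vCoeff_zero : vCoeff 0 = -1 := by
  simp [vCoeff, waveCoeff]

theorem vCoeff_rec (n : ℕ) (hn : 2 ≤ n) :
    vCoeff (n - 1) = (1 / 2) * ∑ m ∈ Finset.Icc 1 (n - 1),
      ∑ l ∈ Finset.Icc 1 (min m (n - m - 1)), uCoeff m l * uCoeff (n - m) (1 + l) := by
  obtain ⟨n, rfl⟩ : ∃ j, n = j + 2 := ⟨n - 2, by omega⟩
  have h1 : vCoeff (n + 2 - 1) = (waveCoeff (n + 2)).2 := rfl
  rw [h1, waveCoeff]
  simp only [vNext]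
  congr 1
  refine Finset.sum_congr rfl fun m hm => Finset.sum_congr rfl fun l hl => ?_
  rw [Finset.mem_Icc] at hm
  rw [dif_pos (show m < n + 2 by omega), dif_pos (show n + 2 - m < n + 2 by omega)]
  rfl

theorem uCoeff_eq_zero (n k : ℕ) (hn : 2 ≤ n) (hk : ¬ (2 ≤ k ∧ k ≤ n)) : uCoeff n k = 0 := by
  obtain ⟨n, rfl⟩ : ∃ j, n = j + 2 := ⟨n - 2, by omega⟩
  rw [uCoeff, waveCoeff]
  simp only [uNext, if_neg hk]

theorem uCoeff_rec (n k : ℕ) (hk : 2 ≤ k) (hkn : k ≤ n) :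
    (1 - (k : ℝ)) * uCoeff n k
      + k * ∑ m ∈ Finset.Icc 1 (n - k), vCoeff m * uCoeff (n - m) k
      - (k / 4) * ∑ m ∈ Finset.Icc 1 (n - 1),
          ∑ l ∈ Finset.Icc (max 1 (k + m - n)) (min m (k - 1)),
            uCoeff m l * uCoeff (n - m) (k - l)
      - (k / 2) * ∑ m ∈ Finset.Icc 1 (n - 1),
          ∑ l ∈ Finset.Icc 1 (min m (n - m - k)), uCoeff m l * uCoeff (n - m) (k + l) = 0 := by
  obtain ⟨n, rfl⟩ : ∃ j, n = j + 2 := ⟨n - 2, by omega⟩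
  have hk1 : (k : ℝ) - 1 ≠ 0 := by
    have : (2 : ℝ) ≤ k := by exact_mod_cast hk
    linarith
  have e1 : uCoeff (n + 2) k = uNext (n + 2) uCoeff vCoeff k := by
    rw [uCoeff, waveCoeff]
    simp only [uNext, if_pos (And.intro hk hkn)]
    congr 2
    · congr 2
      · refine Finset.sum_congr rfl fun m hm => ?_
        rw [Finset.mem_Icc] at hm
        rw [dif_pos (show m + 1 < n + 2 by omega), dif_pos (show n + 2 - m < n + 2 by omega)]
        rfl
      · refine Finset.sum_congr rfl fun m hm => Finset.sum_congr rfl fun l hl => ?_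
        rw [Finset.mem_Icc] at hm
        rw [dif_pos (show m < n + 2 by omega), dif_pos (show n + 2 - m < n + 2 by omega)]
        rfl
    · congr 1
      refine Finset.sum_congr rfl fun m hm => Finset.sum_congr rfl fun l hl => ?_
      rw [Finset.mem_Icc] at hm
      rw [dif_pos (show m < n + 2 by omega), dif_pos (show n + 2 - m < n + 2 by omega)]
      rfl
  rw [e1, uNext, if_pos ⟨hk, hkn⟩]
  field_simp
  ring

/-- The vanishing `u_{n,k} = 0` for `n - k` odd is automatic, as is `v_n = 0` for `n` odd. -/
theorem parity_vanishing (n : ℕ) :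
    (∀ k, Odd (n + k) → uCoeff n k = 0) ∧ (Odd n → vCoeff n = 0) := by
  have key : ∀ n, ∀ k, Odd (n + k) → uCoeff n k = 0 := by
    intro n
    induction n using Nat.strong_induction_on with
    | _ n ih =>
      have hv : ∀ j, j + 1 ≤ n → Odd j → vCoeff j = 0 := by
        intro j hj hodd
        have h := vCoeff_rec (j + 1) (by have := hodd.pos; omega)
        rw [Nat.add_sub_cancel] at h
        rw [h]
        refine mul_eq_zero_of_right _ (Finset.sum_eq_zero fun m hm =>
          Finset.sum_eq_zero fun l hl => ?_)
        rw [Finset.mem_Icc] at hm hl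
        rcases Nat.even_or_odd (m + l) with he | ho
        · rw [ih (j + 1 - m) (by omega) (1 + l) (by grind), mul_zero]
        · rw [ih m (by omega) l ho, zero_mul]
      intro k hk
      rcases Nat.lt_or_ge n 2 with hn | hn
      · interval_cases n
        · simp [uCoeff, waveCoeff]
        · rw [uCoeff_one, Pi.single_apply, if_neg]
          rintro rfl
          exact absurd hk (by decide)
      by_cases hkn : 2 ≤ k ∧ k ≤ n
      · have h := uCoeff_rec n k hkn.1 hkn.2
        have s1 : ∑ m ∈ Finset.Icc 1 (n - k), vCoeff m * uCoeff (n - m) k = 0 := by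
          refine Finset.sum_eq_zero fun m hm => ?_
          rw [Finset.mem_Icc] at hm
          rcases Nat.even_or_odd m with he | ho
          · rw [ih (n - m) (by omega) k (by grind), mul_zero]
          · rw [hv m (by omega) ho, zero_mul]
        have s2 : ∑ m ∈ Finset.Icc 1 (n - 1),
            ∑ l ∈ Finset.Icc (max 1 (k + m - n)) (min m (k - 1)),
              uCoeff m l * uCoeff (n - m) (k - l) = 0 := by
          refine Finset.sum_eq_zero fun m hm => Finset.sum_eq_zero fun l hl => ?_
          rw [Finset.mem_Icc] at hm hl
          rcases Nat.even_or_odd (m + l) with he | ho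
          · rw [ih (n - m) (by omega) (k - l) (by grind), mul_zero]
          · rw [ih m (by omega) l ho, zero_mul]
        have s3 : ∑ m ∈ Finset.Icc 1 (n - 1),
            ∑ l ∈ Finset.Icc 1 (min m (n - m - k)),
              uCoeff m l * uCoeff (n - m) (k + l) = 0 := by
          refine Finset.sum_eq_zero fun m hm => Finset.sum_eq_zero fun l hl => ?_
          rw [Finset.mem_Icc] at hm hl
          rcases Nat.even_or_odd (m + l) with he | ho
          · rw [ih (n - m) (by omega) (k + l) (by grind), mul_zero]
          · rw [ih m (by omega) l ho, zero_mul]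
        rw [s1, s2, s3] at h
        have hk1 : (1 : ℝ) - k ≠ 0 := by
          have : (2 : ℝ) ≤ k := by exact_mod_cast hkn.1
          linarith
        simpa [hk1] using h
      · exact uCoeff_eq_zero n k hn hkn
  refine ⟨key n, fun hodd => ?_⟩
  have h := vCoeff_rec (n + 1) (by have := hodd.pos; omega)
  rw [Nat.add_sub_cancel] at h
  rw [h]
  refine mul_eq_zero_of_right _ (Finset.sum_eq_zero fun m hm =>
    Finset.sum_eq_zero fun l hl => ?_)
  rw [Finset.mem_Icc] at hm hl
  rcases Nat.even_or_odd (m + l) with he | ho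
  · rw [key (n + 1 - m) (1 + l) (by grind), mul_zero]
  · rw [key m l ho, zero_mul]

/-! ### The number `x*` -/

/-- The constant `B = √(π²/3 + 869/144) ≈ 3.05`. -/
def B : ℝ := Real.sqrt (Real.pi ^ 2 / 3 + 869 / 144)

/-- `x*`: the largest `x ≥ 0` satisfying the inequality below
(the set is nonempty and bounded, since the inequality forces `8 x ≤ 4`). -/
def xStar : ℝ :=
  sSup {x : ℝ | 0 ≤ x ∧
    8 * x + Real.sqrt 17 * x ^ 2 - 4 ≤
      -2 * Real.sqrt ((2 * B * x ^ 2 + 4 * x) *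
        (x * Real.sqrt (x ^ 2 + 5 / 2) + 5 / 2 * Real.arsinh (Real.sqrt (2 / 5) * x)))}

/-! ### Periodic functions, `H¹(𝕋)`, the Hilbert transform, traveling waves -/

/-- Lebesgue measure on one period `(-π, π]`. -/
def periodMeasure : Measure ℝ := volume.restrict (Set.Ioc (-Real.pi) Real.pi)

/-- The `H¹(𝕋)` norm of a smooth `2π`-periodic function. -/
def h1Norm (f : ℝ → ℝ) : ℝ :=
  Real.sqrt (∫ x in (-Real.pi)..Real.pi, (f x ^ 2 + deriv f x ^ 2))

/-- `u` is a `2π`-periodic function in `H¹(𝕋)` with weak derivative `w ∈ L²(𝕋)`;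
`w` only matters on one period. -/
structure IsH1WithDeriv (u w : ℝ → ℂ) : Prop where
  periodic : Function.Periodic u (2 * Real.pi)
  memLp : MemLp u 2 periodMeasure
  memLp_deriv : MemLp w 2 periodMeasure
  weak_deriv : ∀ φ : ℝ → ℂ, ContDiff ℝ (⊤ : ℕ∞) φ → Function.Periodic φ (2 * Real.pi) →
    ∫ x in (-Real.pi)..Real.pi, u x * deriv φ x = -∫ x in (-Real.pi)..Real.pi, w x * φ x

/-- The `k`-th Fourier coefficient of a `2π`-periodic function. -/
def fCoeff (f : ℝ → ℂ) (k : ℤ) : ℂ :=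
  (1 / (2 * Real.pi)) * ∫ x in (-Real.pi)..Real.pi, Complex.exp (-(Complex.I * k * x)) * f x

/-- `g ∈ L²(𝕋)` is the Hilbert transform of `f ∈ L²(𝕋)`, the Fourier multiplier `-i sgn k`. -/
def IsHilbertTransform (f g : ℝ → ℂ) : Prop :=
  MemLp g 2 periodMeasure ∧ ∀ k : ℤ, fCoeff g k = -Complex.I * (Int.sign k : ℂ) * fCoeff f k

/-- `u ∈ H¹(𝕋)`, with weak derivative `w`, solves `H u - v u' + u u' = 0`, that is,
`u (x + v t)` is a traveling wave of `f_t = H f + f f_x`. -/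
def IsTravelingWave (u w : ℝ → ℂ) (v : ℂ) : Prop :=
  IsH1WithDeriv u w ∧ ∃ g : ℝ → ℂ, IsHilbertTransform u g ∧
    ∀ᵐ x ∂periodMeasure, g x - v * w x + u x * w x = 0

/-- The series `∑ u_n ε^n` converges in `H¹(𝕋)` to `u`, whose weak derivative is `w`. -/
def ConvergesInH1 (ε : ℂ) (u w : ℝ → ℂ) : Prop :=
  IsH1WithDeriv u w ∧
  Tendsto (fun N : ℕ =>
    eLpNorm (fun x => (∑ n ∈ Finset.range N, (uTerm n x : ℂ) * ε ^ n) - u x) 2 periodMeasure +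
    eLpNorm (fun x => (∑ n ∈ Finset.range N, ((deriv (uTerm n) x : ℝ) : ℂ) * ε ^ n) - w x) 2
      periodMeasure) atTop (𝓝 0)

end BurgersHilbert

end

/-!
The idea is to work with formal power series in `ε`. Let `U_k = ∑_n u_{n,k} ε ^ n` be the
coefficient of `cos (k x)` in `u_ε`, and let `S_k` be that of `u_ε ^ 2`. The recurrence says that
`(k - 1) U_k = k (v_ε + 1) U_k - (k / 2) S_k` for every `k`, the case `k = 1`, with `U_1 = ε`,
being the recurrence for `v_ε`. This is the Fourier expansion of the wave equation, so that the
latter holds order by order in `ε`.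

For convergence, let `‖·‖` be the `ℓ¹` norm with weights `r ^ n`, `r = 4 / 15`, which is
submultiplicative. By induction on the truncation order, `‖U_k‖` is at most
`M_k = (4 / 15) (1 / 5) ^ (k - 1) catalan (k - 1)`: convolving `M` with itself gives `4 / 3 * M`,
and `M` decays like `(4 / 5) ^ k`, which bounds the interactions of the modes `l` and `k + l` by
`4 / 15 * M_k`. Together with `‖v_ε + 1‖ ≤ 1 / 30` the right-hand side of the recurrence is at
most `(k / 2) M_k ≤ (k - 1) M_k`. As `∑ (k + 1) M_k` is finite, the series converge in `H¹` and
uniformly, with their derivatives, for `|ε| ≤ 4 / 15`. Since `x* < 0.235 < 4 / 15`, this covers the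
disc `|ε| < x*`.
-/

namespace BurgersHilbert

open Finset hiding antidiagonal mem_antidiagonal
open Finset.HasAntidiagonal (antidiagonal mem_antidiagonal)
open PowerSeries
open scoped NNReal

section PartialNorm

variable {𝕜 : Type*} [NormedField 𝕜]

/-- The truncated weighted `ℓ¹` seminorm `∑_{n < N} ‖a_n‖ r ^ n` of a formal power series
`∑ a_n X ^ n`. Bounds on it which are uniform in `N` express absolute convergence at radius `r`. -/
noncomputable def partialNorm (r : ℝ≥0) (N : ℕ) : Seminorm 𝕜 𝕜⟦X⟧ :=
  ∑ n ∈ range N, r ^ n • (normSeminorm 𝕜 𝕜).comp (coeff n)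

theorem partialNorm_apply (r : ℝ≥0) (N : ℕ) (F : 𝕜⟦X⟧) :
    partialNorm r N F = ∑ n ∈ range N, (r : ℝ) ^ n * ‖coeff n F‖ := by
  induction N with
  | zero => rfl
  | succ N ih => rw [sum_range_succ, ← ih, partialNorm, sum_range_succ]; rfl

theorem partialNorm_congr (r : ℝ≥0) {N : ℕ} {F G : 𝕜⟦X⟧}
    (h : ∀ n < N, coeff n F = coeff n G) : partialNorm r N F = partialNorm r N G := by
  simp only [partialNorm_apply]
  exact sum_congr rfl fun n hn => by rw [h n (mem_range.1 hn)]

theorem partialNorm_sum_le {ι : Type*} (r : ℝ≥0) (N : ℕ) (s : Finset ι) (F : ι → 𝕜⟦X⟧) :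
    partialNorm r N (∑ i ∈ s, F i) ≤ ∑ i ∈ s, partialNorm r N (F i) :=
  le_sum_of_subadditive _ (map_zero _).le (map_add_le_add _) s F

theorem partialNorm_succ_X_mul (r : ℝ≥0) (N : ℕ) (F : 𝕜⟦X⟧) :
    partialNorm r (N + 1) (X * F) = r * partialNorm r N F := by
  simp only [partialNorm_apply, sum_range_succ' _ N, coeff_succ_X_mul, coeff_zero_X_mul,
    norm_zero, mul_zero, add_zero, mul_sum, pow_succ']
  exact sum_congr rfl fun n _ => by ring

theorem partialNorm_one_le (r : ℝ≥0) (N : ℕ) : partialNorm r N (1 : 𝕜⟦X⟧) ≤ 1 := by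
  simp only [partialNorm_apply, coeff_one, apply_ite norm, norm_one, norm_zero, mul_ite, mul_one,
    mul_zero, sum_ite_eq', mem_range]
  split_ifs <;> norm_num

theorem sum_range_sum_antidiagonal_le {f g : ℕ → ℝ} (hf : ∀ n, 0 ≤ f n) (hg : ∀ n, 0 ≤ g n)
    (N : ℕ) : ∑ n ∈ range N, ∑ p ∈ antidiagonal n, f p.1 * g p.2 ≤
      (∑ n ∈ range N, f n) * ∑ n ∈ range N, g n := by
  have fiber (n : ℕ) (hn : n ∈ range N) :
      {p ∈ range N ×ˢ range N | p.1 + p.2 = n} = antidiagonal n := by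
    ext p
    simp only [mem_filter, mem_product, mem_range, mem_antidiagonal] at hn ⊢
    omega
  calc ∑ n ∈ range N, ∑ p ∈ antidiagonal n, f p.1 * g p.2
      = ∑ n ∈ range N, ∑ p ∈ range N ×ˢ range N with p.1 + p.2 = n, f p.1 * g p.2 :=
        sum_congr rfl fun n hn => by rw [fiber n hn]
    _ ≤ ∑ p ∈ range N ×ˢ range N, f p.1 * g p.2 :=
        sum_fiberwise_le_sum_of_sum_fiber_nonneg fun _ _ =>
          sum_nonneg fun p _ => mul_nonneg (hf p.1) (hg p.2)
    _ = (∑ n ∈ range N, f n) * ∑ n ∈ range N, g n := by rw [sum_mul_sum, sum_product]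

theorem partialNorm_mul_le (r : ℝ≥0) (N : ℕ) (F G : 𝕜⟦X⟧) :
    partialNorm r N (F * G) ≤ partialNorm r N F * partialNorm r N G := by
  simp only [partialNorm_apply]
  refine le_trans (sum_le_sum fun n _ => ?_) (sum_range_sum_antidiagonal_le
    (fun n => by positivity) (fun n => by positivity) N)
  rw [coeff_mul]
  calc (r : ℝ) ^ n * ‖∑ p ∈ antidiagonal n, coeff p.1 F * coeff p.2 G‖
      ≤ (r : ℝ) ^ n * ∑ p ∈ antidiagonal n, ‖coeff p.1 F * coeff p.2 G‖ := by
        gcongr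
        exact norm_sum_le _ _
    _ = ∑ p ∈ antidiagonal n, r ^ p.1 * ‖coeff p.1 F‖ * (r ^ p.2 * ‖coeff p.2 G‖) := by
        rw [mul_sum]
        refine sum_congr rfl fun p hp => ?_
        rw [← mem_antidiagonal.1 hp, pow_add, norm_mul]
        ring

theorem partialNorm_succ_mul_le (r : ℝ≥0) (N : ℕ) {F G : 𝕜⟦X⟧} (hF : constantCoeff F = 0)
    (hG : constantCoeff G = 0) :
    partialNorm r (N + 1) (F * G) ≤ partialNorm r N F * partialNorm r N G := by
  obtain ⟨F, rfl⟩ := X_dvd_iff.2 hF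
  obtain ⟨G, rfl⟩ := X_dvd_iff.2 hG
  rw [mul_assoc, partialNorm_succ_X_mul, mul_left_comm]
  cases N with
  | zero => simp [partialNorm_apply]
  | succ N =>
    simp only [partialNorm_succ_X_mul]
    calc (r : ℝ) * (r * partialNorm r N (F * G))
        ≤ r * (r * (partialNorm r N F * partialNorm r N G)) := by
          gcongr
          exact partialNorm_mul_le r N F G
      _ = r * partialNorm r N F * (r * partialNorm r N G) := by ring

end PartialNorm

section Catalan

theorem catalan_add_le (n l : ℕ) : catalan (n + l) ≤ 4 ^ l * catalan n := by
  induction l with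
  | zero => simp
  | succ l ih =>
    have ratio : (n + l + 2) * catalan (n + l + 1) = (4 * (n + l) + 2) * catalan (n + l) := by
      have h := Nat.succ_mul_centralBinom_succ (n + l)
      rw [← succ_mul_catalan_eq_centralBinom, ← succ_mul_catalan_eq_centralBinom] at h
      exact Nat.eq_of_mul_eq_mul_left (Nat.succ_pos (n + l)) (by linarith)
    rw [pow_succ', mul_assoc, ← add_assoc]
    refine le_trans (Nat.le_of_mul_le_mul_left (c := n + l + 2) ?_ (by omega))
      (Nat.mul_le_mul_left 4 ih)
    rw [ratio]
    nlinarith [Nat.zero_le (catalan (n + l))]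

/-- Iterating `c ↦ 1 + x c ^ 2` from `0` never exceeds a supersolution. -/
theorem sum_catalan_mul_pow_le {x c : ℝ} (hx : 0 ≤ x) (hc : 0 ≤ c) (h : 1 + x * c ^ 2 ≤ c)
    (N : ℕ) : ∑ k ∈ range N, catalan k * x ^ k ≤ c := by
  induction N with
  | zero => simpa using hc
  | succ N ih =>
    have : 0 ≤ ∑ k ∈ range N, catalan k * x ^ k := by positivity
    calc ∑ k ∈ range (N + 1), catalan k * x ^ k
        = 1 + x * ∑ k ∈ range N, ∑ p ∈ antidiagonal k,
            catalan p.1 * x ^ p.1 * (catalan p.2 * x ^ p.2) := by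
          rw [sum_range_succ', catalan_zero, Nat.cast_one, pow_zero, mul_one, add_comm, mul_sum]
          congr 1
          refine sum_congr rfl fun k _ => ?_
          rw [catalan_succ', Nat.cast_sum, sum_mul, mul_sum]
          refine sum_congr rfl fun p hp => ?_
          rw [← mem_antidiagonal.1 hp]
          push_cast
          ring
      _ ≤ 1 + x * ((∑ k ∈ range N, catalan k * x ^ k) * ∑ k ∈ range N, catalan k * x ^ k) := by
          gcongr
          exact sum_range_sum_antidiagonal_le (f := fun k => catalan k * x ^ k)
            (g := fun k => catalan k * x ^ k) (fun k => by positivity) (fun k => by positivity) N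
      _ ≤ 1 + x * c ^ 2 := by
          rw [← sq]
          gcongr
      _ ≤ c := h

/-- The bound for `∑_n |u_{n,k}| (4/15) ^ n`. A rescaled Catalan sequence reproduces itself under
convolution, so that it absorbs the quadratic terms of the recurrence. -/
noncomputable def majorant : ℕ → ℝ
  | 0 => 0
  | k + 1 => 4 / 15 * (1 / 5) ^ k * catalan k

theorem majorant_nonneg (k : ℕ) : 0 ≤ majorant k := by
  cases k with
  | zero => exact le_rfl
  | succ k => rw [majorant]; positivity

theorem sum_antidiagonal_majorant (k : ℕ) :
    ∑ q ∈ antidiagonal (k + 2), majorant q.1 * majorant q.2 = 4 / 3 * majorant (k + 2) := by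
  rw [Finset.Nat.sum_antidiagonal_succ, Finset.Nat.sum_antidiagonal_succ']
  simp only [majorant, zero_mul, mul_zero, sum_const_zero, zero_add, catalan_succ', Nat.cast_sum,
    mul_sum]
  refine sum_congr rfl fun q hq => ?_
  rw [← mem_antidiagonal.1 hq]
  push_cast
  ring

theorem majorant_add_le {k : ℕ} (hk : k ≠ 0) (l : ℕ) :
    majorant (k + l) ≤ (4 / 5) ^ l * majorant k := by
  obtain ⟨k, rfl⟩ := Nat.exists_eq_succ_of_ne_zero hk
  have h : (catalan (k + l) : ℝ) ≤ 4 ^ l * catalan k := by exact_mod_cast catalan_add_le k l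
  rw [Nat.succ_add, majorant, majorant]
  calc 4 / 15 * (1 / 5 : ℝ) ^ (k + l) * catalan (k + l)
      ≤ 4 / 15 * (1 / 5 : ℝ) ^ (k + l) * (4 ^ l * catalan k) := by gcongr
    _ = (4 / 5) ^ l * (4 / 15 * (1 / 5) ^ k * catalan k) := by
        rw [pow_add, show (4 / 5 : ℝ) = 1 / 5 * 4 by norm_num, mul_pow]
        ring

theorem majorant_le_pow (k : ℕ) : majorant k ≤ (4 / 5) ^ k := by
  cases k with
  | zero => norm_num [majorant]
  | succ k =>
    have h := majorant_add_le one_ne_zero k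
    have : (0 : ℝ) < (4 / 5) ^ k := by positivity
    rw [show majorant 1 = 4 / 15 by norm_num [majorant], add_comm] at h
    rw [pow_succ]
    linarith

theorem sum_majorant_mul_pow_le (N : ℕ) :
    ∑ l ∈ range N, majorant l * (4 / 5) ^ l ≤ 4 / 15 := by
  cases N with
  | zero => norm_num
  | succ N =>
    have h := sum_catalan_mul_pow_le (x := 4 / 25) (c := 5 / 4) (by norm_num) (by norm_num)
      (by norm_num) N
    calc ∑ l ∈ range (N + 1), majorant l * (4 / 5) ^ l
        = 16 / 75 * ∑ k ∈ range N, (catalan k : ℝ) * (4 / 25) ^ k := by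
          rw [sum_range_succ', majorant, zero_mul, add_zero, mul_sum]
          refine sum_congr rfl fun k _ => ?_
          rw [majorant, show (4 / 25 : ℝ) = 1 / 5 * (4 / 5) by norm_num, mul_pow]
          ring
      _ ≤ 4 / 15 := by linarith

theorem sum_majorant_mul_majorant_add_le {k : ℕ} (hk : k ≠ 0) (N : ℕ) :
    ∑ l ∈ range N, majorant l * majorant (k + l) ≤ 4 / 15 * majorant k :=
  calc ∑ l ∈ range N, majorant l * majorant (k + l)
      ≤ ∑ l ∈ range N, majorant l * ((4 / 5) ^ l * majorant k) :=
        sum_le_sum fun l _ => mul_le_mul_of_nonneg_left (majorant_add_le hk l) (majorant_nonneg l)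
    _ = (∑ l ∈ range N, majorant l * (4 / 5) ^ l) * majorant k := by
        simp only [sum_mul, mul_assoc]
    _ ≤ 4 / 15 * majorant k :=
        mul_le_mul_of_nonneg_right (sum_majorant_mul_pow_le N) (majorant_nonneg k)

theorem sum_majorant_mul_majorant_one_add_le (N : ℕ) :
    ∑ l ∈ range N, majorant l * majorant (1 + l) ≤ 4 / 225 := by
  have term_le (l : ℕ) : majorant l * majorant (1 + l) ≤ 1 / 15 * (majorant l * (4 / 5) ^ l) := by
    cases l with
    | zero => simp [majorant]
    | succ l =>
      have h : majorant (1 + (l + 1)) ≤ 1 / 15 * (4 / 5) ^ (l + 1) := by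
        have := majorant_add_le two_ne_zero l
        rw [show majorant 2 = 4 / 75 by norm_num [majorant]] at this
        rw [show 1 + (l + 1) = 2 + l by ring, pow_succ]
        linarith
      nlinarith [majorant_nonneg (l + 1)]
  have h := sum_le_sum fun l (_ : l ∈ range N) => term_le l
  rw [← mul_sum] at h
  linarith [sum_majorant_mul_pow_le N]

end Catalan

section FormalSeries

theorem uCoeff_zero_left (k : ℕ) : uCoeff 0 k = 0 := by simp [uCoeff, waveCoeff]

theorem uCoeff_eq_zero_of_lt {n k : ℕ} (h : n < k) : uCoeff n k = 0 := by
  match n with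
  | 0 => exact uCoeff_zero_left k
  | 1 => rw [uCoeff_one, Pi.single_eq_of_ne (by omega)]
  | n + 2 => exact uCoeff_eq_zero _ k (by omega) (by omega)

theorem uCoeff_zero_right (n : ℕ) : uCoeff n 0 = 0 := by
  match n with
  | 0 => exact uCoeff_zero_left 0
  | 1 => rw [uCoeff_one, Pi.single_eq_of_ne (by omega)]
  | n + 2 => exact uCoeff_eq_zero _ 0 (by omega) (by omega)

theorem uCoeff_one_right (n : ℕ) : uCoeff n 1 = if n = 1 then 1 else 0 := by
  match n with
  | 0 => exact uCoeff_zero_left 1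
  | 1 => rw [uCoeff_one, Pi.single_eq_same, if_pos rfl]
  | n + 2 => exact uCoeff_eq_zero _ 1 (by omega) (by omega)

/-- The formal series `∑_n u_{n,k} X ^ n`, the coefficient of `cos (k x)` in `u_ε`. -/
noncomputable def modeSeries (k : ℕ) : ℝ⟦X⟧ := .mk fun n => uCoeff n k

/-- The formal series `∑_n v_n X ^ n` of the speed. -/
noncomputable def vSeries : ℝ⟦X⟧ := .mk vCoeff

/-- The coefficient of `cos (k x)`, for `k ≥ 1`, in `u_ε ^ 2`, as a formal series in `ε`. The sum
over the pairs of modes with difference `k` is infinite; only those with `l ≤ n` contribute to the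
coefficient of `X ^ n`. -/
noncomputable def squareMode (k : ℕ) : ℝ⟦X⟧ := .mk fun n =>
  1 / 2 * ∑ q ∈ antidiagonal k, coeff n (modeSeries q.1 * modeSeries q.2) +
    ∑ l ∈ range (n + 1), coeff n (modeSeries l * modeSeries (k + l))

theorem coeff_modeSeries (n k : ℕ) : coeff n (modeSeries k) = uCoeff n k := coeff_mk _ _

theorem modeSeries_zero : modeSeries 0 = 0 := by
  ext n
  rw [coeff_modeSeries, uCoeff_zero_right, map_zero]

theorem modeSeries_one : modeSeries 1 = X := by
  ext n
  rw [coeff_modeSeries, uCoeff_one_right, coeff_X]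

theorem constantCoeff_modeSeries (k : ℕ) : constantCoeff (modeSeries k) = 0 := by
  rw [← coeff_zero_eq_constantCoeff_apply, coeff_modeSeries, uCoeff_zero_left]

theorem constantCoeff_vSeries_add_one : constantCoeff (vSeries + 1) = 0 := by
  rw [map_add, map_one, ← coeff_zero_eq_constantCoeff_apply, vSeries, coeff_mk, vCoeff_zero,
    neg_add_cancel]

theorem coeff_vSeries_add_one {n : ℕ} (hn : n ≠ 0) : coeff n (vSeries + 1) = vCoeff n := by
  rw [map_add, coeff_one, if_neg hn, add_zero, vSeries, coeff_mk]

theorem coeff_mul_modeSeries_eq_zero {F : ℝ⟦X⟧} {n k : ℕ} (hF : constantCoeff F = 0)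
    (h : n ≤ k) : coeff n (F * modeSeries k) = 0 := by
  rw [coeff_mul]
  refine sum_eq_zero fun p hp => ?_
  rcases eq_or_ne p.1 0 with h0 | h0
  · rw [h0, coeff_zero_eq_constantCoeff_apply, hF, zero_mul]
  · rw [coeff_modeSeries, uCoeff_eq_zero_of_lt (by have := mem_antidiagonal.1 hp; omega), mul_zero]

theorem coeff_modeSeries_mul_modeSeries_eq_zero {n i j : ℕ} (h : n < i + j) :
    coeff n (modeSeries i * modeSeries j) = 0 := by
  rw [coeff_mul]
  refine sum_eq_zero fun p hp => ?_
  rw [mem_antidiagonal] at hp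
  rw [coeff_modeSeries, coeff_modeSeries]
  obtain hi | hj : p.1 < i ∨ p.2 < j := by omega
  · rw [uCoeff_eq_zero_of_lt hi, zero_mul]
  · rw [uCoeff_eq_zero_of_lt hj, mul_zero]

theorem coeff_squareMode {n N : ℕ} (hN : n ≤ N) (k : ℕ) : coeff n (squareMode k) =
    coeff n ((1 / 2 : ℝ) • ∑ q ∈ antidiagonal k, modeSeries q.1 * modeSeries q.2 +
      ∑ l ∈ range (N + 1), modeSeries l * modeSeries (k + l)) := by
  rw [squareMode, coeff_mk, map_add, map_smul, map_sum, map_sum, smul_eq_mul]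
  congr 1
  refine sum_subset (range_mono (by omega)) fun l _ hl => ?_
  rw [mem_range] at hl
  exact coeff_modeSeries_mul_modeSeries_eq_zero (by omega)

theorem coeff_squareMode_eq_zero {n k : ℕ} (h : n < k) : coeff n (squareMode k) = 0 := by
  rw [squareMode, coeff_mk, sum_eq_zero, sum_eq_zero, mul_zero, add_zero]
  · exact fun l _ => coeff_modeSeries_mul_modeSeries_eq_zero (by omega)
  · exact fun q hq => coeff_modeSeries_mul_modeSeries_eq_zero (by rwa [mem_antidiagonal.1 hq])

theorem coeff_mul_eq_sum_Icc {R : Type*} [Semiring R] {F G : R⟦X⟧} (hF : constantCoeff F = 0)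
    (hG : constantCoeff G = 0) (n : ℕ) :
    coeff n (F * G) = ∑ m ∈ Icc 1 (n - 1), coeff m F * coeff (n - m) G := by
  rw [coeff_mul,
    Finset.Nat.sum_antidiagonal_eq_sum_range_succ (fun a b => coeff a F * coeff b G)]
  refine (sum_subset (fun m hm => ?_) fun m hm hm' => ?_).symm <;>
    simp only [mem_Icc, mem_range] at hm ⊢
  · omega
  rw [mem_Icc] at hm'
  obtain rfl | hnm : m = 0 ∨ n - m = 0 := by omega
  · rw [coeff_zero_eq_constantCoeff_apply, hF, zero_mul]
  · rw [hnm, coeff_zero_eq_constantCoeff_apply, hG, mul_zero]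

theorem coeff_modeSeries_mul_modeSeries (n i j : ℕ) : coeff n (modeSeries i * modeSeries j) =
    ∑ m ∈ Icc 1 (n - 1), uCoeff m i * uCoeff (n - m) j := by
  simp only [coeff_mul_eq_sum_Icc (constantCoeff_modeSeries i) (constantCoeff_modeSeries j),
    coeff_modeSeries]

theorem sum_coeff_sum_modes (n k : ℕ) :
    ∑ q ∈ antidiagonal k, coeff n (modeSeries q.1 * modeSeries q.2) =
      ∑ m ∈ Icc 1 (n - 1), ∑ l ∈ Icc (max 1 (k + m - n)) (min m (k - 1)),
        uCoeff m l * uCoeff (n - m) (k - l) := by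
  simp only [coeff_modeSeries_mul_modeSeries]
  rw [sum_comm]
  refine sum_congr rfl fun m _ => ?_
  rw [Finset.Nat.sum_antidiagonal_eq_sum_range_succ (fun i j => uCoeff m i * uCoeff (n - m) j)]
  refine (sum_subset (fun l hl => ?_) fun l hl hl' => ?_).symm <;>
    simp only [mem_Icc, mem_range] at hl ⊢
  · omega
  rw [mem_Icc] at hl'
  obtain rfl | hm | rfl | hnm : l = 0 ∨ m < l ∨ l = k ∨ n - m < k - l := by omega
  · rw [uCoeff_zero_right, zero_mul]
  · rw [uCoeff_eq_zero_of_lt hm, zero_mul]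
  · rw [Nat.sub_self, uCoeff_zero_right, mul_zero]
  · rw [uCoeff_eq_zero_of_lt hnm, mul_zero]

theorem sum_coeff_difference_modes (n k : ℕ) :
    ∑ l ∈ range (n + 1), coeff n (modeSeries l * modeSeries (k + l)) =
      ∑ m ∈ Icc 1 (n - 1), ∑ l ∈ Icc 1 (min m (n - m - k)),
        uCoeff m l * uCoeff (n - m) (k + l) := by
  simp only [coeff_modeSeries_mul_modeSeries]
  rw [sum_comm]
  refine sum_congr rfl fun m hm => ?_
  refine (sum_subset (fun l hl => ?_) fun l hl hl' => ?_).symm <;>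
    simp only [mem_Icc, mem_range] at hm hl ⊢
  · omega
  rw [mem_Icc] at hl'
  obtain rfl | hml | hnm : l = 0 ∨ m < l ∨ n - m < k + l := by omega
  · rw [uCoeff_zero_right, zero_mul]
  · rw [uCoeff_eq_zero_of_lt hml, zero_mul]
  · rw [uCoeff_eq_zero_of_lt hnm, mul_zero]

theorem X_mul_vSeries_add_one : X * (vSeries + 1) = (1 / 2 : ℝ) • squareMode 1 := by
  have sum_modes (n : ℕ) :
      ∑ q ∈ antidiagonal 1, coeff n (modeSeries q.1 * modeSeries q.2) = 0 := by
    simp [Finset.Nat.antidiagonal_succ, modeSeries_zero]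
  ext n
  rw [map_smul, smul_eq_mul]
  match n with
  | 0 => rw [coeff_zero_X_mul, coeff_squareMode_eq_zero one_pos, mul_zero]
  | 1 =>
    rw [coeff_succ_X_mul, coeff_zero_eq_constantCoeff_apply, constantCoeff_vSeries_add_one,
      squareMode, coeff_mk, sum_modes, sum_coeff_difference_modes]
    simp
  | n + 2 =>
    rw [coeff_succ_X_mul, coeff_vSeries_add_one (by omega), squareMode, coeff_mk, sum_modes,
      sum_coeff_difference_modes, mul_zero, zero_add]
    exact vCoeff_rec (n + 2) (by omega)

theorem modeSeries_rec (k : ℕ) : (1 - k : ℝ) • modeSeries k +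
    (k : ℝ) • ((vSeries + 1) * modeSeries k) = (k / 2 : ℝ) • squareMode k := by
  rcases Nat.lt_or_ge k 2 with hk | hk
  · interval_cases k
    · simp [modeSeries_zero]
    · simp [modeSeries_one, mul_comm _ X, X_mul_vSeries_add_one]
  ext n
  simp only [map_add, map_smul, smul_eq_mul, coeff_modeSeries]
  rcases Nat.lt_or_ge n k with hnk | hkn
  · rw [uCoeff_eq_zero_of_lt hnk, coeff_squareMode_eq_zero hnk,
      coeff_mul_modeSeries_eq_zero constantCoeff_vSeries_add_one hnk.le]
    ring
  have speed_term : coeff n ((vSeries + 1) * modeSeries k) =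
      ∑ m ∈ Icc 1 (n - k), vCoeff m * uCoeff (n - m) k := by
    rw [coeff_mul_eq_sum_Icc constantCoeff_vSeries_add_one (constantCoeff_modeSeries k)]
    refine (sum_congr rfl fun m hm => ?_).trans
      (sum_subset (Icc_subset_Icc_right (by omega)) fun m hm hm' => ?_).symm
    · rw [mem_Icc] at hm
      rw [coeff_vSeries_add_one (by omega), coeff_modeSeries]
    · rw [mem_Icc] at hm hm'
      rw [uCoeff_eq_zero_of_lt (by omega), mul_zero]
  rw [speed_term, squareMode, coeff_mk, sum_coeff_sum_modes, sum_coeff_difference_modes]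
  linear_combination uCoeff_rec n k hk hkn

end FormalSeries

section Bounds

theorem partialNorm_squareMode_le (r : ℝ≥0) (N k : ℕ) : partialNorm r (N + 1) (squareMode k) ≤
    1 / 2 * ∑ q ∈ antidiagonal k,
      partialNorm r N (modeSeries q.1) * partialNorm r N (modeSeries q.2) +
    ∑ l ∈ range (N + 1), partialNorm r N (modeSeries l) * partialNorm r N (modeSeries (k + l)) := by
  have mul_le (i j : ℕ) : partialNorm r (N + 1) (modeSeries i * modeSeries j) ≤
      partialNorm r N (modeSeries i) * partialNorm r N (modeSeries j) :=
    partialNorm_succ_mul_le r N (constantCoeff_modeSeries i) (constantCoeff_modeSeries j)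
  rw [partialNorm_congr r fun n hn => coeff_squareMode (Nat.lt_succ_iff.1 hn) k]
  refine (map_add_le_add _ _ _).trans (add_le_add ?_ ?_)
  · rw [map_smul_eq_mul, Real.norm_of_nonneg (by norm_num)]
    gcongr
    exact (partialNorm_sum_le ..).trans (sum_le_sum fun q _ => mul_le q.1 q.2)
  · exact (partialNorm_sum_le ..).trans (sum_le_sum fun l _ => mul_le l (k + l))

/-- The radius at which the majorant controls the coefficient series. -/
noncomputable def convergenceRadius : ℝ≥0 := 4 / 15

theorem coe_convergenceRadius : (convergenceRadius : ℝ) = 4 / 15 := by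
  norm_num [convergenceRadius]

section InductionStep

variable {N : ℕ} (ih : ∀ k, partialNorm convergenceRadius N (modeSeries k) ≤ majorant k)
include ih

theorem sum_partialNorm_mul_le {ι : Type*} (s : Finset ι) (i j : ι → ℕ) :
    ∑ a ∈ s, partialNorm convergenceRadius N (modeSeries (i a)) *
      partialNorm convergenceRadius N (modeSeries (j a)) ≤
    ∑ a ∈ s, majorant (i a) * majorant (j a) :=
  sum_le_sum fun _ _ => mul_le_mul (ih _) (ih _) (apply_nonneg _ _) (majorant_nonneg _)

theorem partialNorm_squareMode_le_majorant {k : ℕ} (hk : 2 ≤ k) :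
    partialNorm convergenceRadius (N + 1) (squareMode k) ≤ 14 / 15 * majorant k := by
  obtain ⟨k, rfl⟩ := Nat.exists_eq_add_of_le' hk
  have h := partialNorm_squareMode_le convergenceRadius N (k + 2)
  have sums := sum_partialNorm_mul_le ih (antidiagonal (k + 2)) Prod.fst Prod.snd
  have differences := sum_partialNorm_mul_le ih (range (N + 1)) id (k + 2 + ·)
  rw [sum_antidiagonal_majorant] at sums
  have tail := sum_majorant_mul_majorant_add_le (k := k + 2) (by omega) (N + 1)
  simp only [id] at differences
  linarith

theorem partialNorm_vSeries_add_one_le :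
    partialNorm convergenceRadius N (vSeries + 1) ≤ 1 / 30 := by
  have square_le : partialNorm convergenceRadius (N + 1) (squareMode 1) ≤ 4 / 225 := by
    refine (partialNorm_squareMode_le convergenceRadius N 1).trans ?_
    have differences := sum_partialNorm_mul_le ih (range (N + 1)) id (1 + ·)
    have sums_vanish : ∑ q ∈ antidiagonal 1, partialNorm convergenceRadius N (modeSeries q.1) *
        partialNorm convergenceRadius N (modeSeries q.2) = 0 := by
      simp [Finset.Nat.antidiagonal_succ, modeSeries_zero]
    rw [sums_vanish, mul_zero, zero_add]
    exact differences.trans (sum_majorant_mul_majorant_one_add_le (N + 1))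
  have h := congrArg (partialNorm convergenceRadius (N + 1)) X_mul_vSeries_add_one
  rw [partialNorm_succ_X_mul, map_smul_eq_mul, Real.norm_of_nonneg (by norm_num),
    coe_convergenceRadius] at h
  linarith

theorem partialNorm_succ_modeSeries_le (k : ℕ) :
    partialNorm convergenceRadius (N + 1) (modeSeries k) ≤ majorant k := by
  rcases Nat.lt_or_ge k 2 with hk | hk
  · interval_cases k
    · rw [modeSeries_zero, map_zero, majorant]
    · rw [modeSeries_one, ← mul_one X, partialNorm_succ_X_mul, coe_convergenceRadius]
      have := partialNorm_one_le (𝕜 := ℝ) convergenceRadius N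
      norm_num [majorant]
      linarith
  have hk' : (2 : ℝ) ≤ k := by exact_mod_cast hk
  have speed : partialNorm convergenceRadius (N + 1) ((vSeries + 1) * modeSeries k) ≤
      1 / 30 * majorant k :=
    (partialNorm_succ_mul_le _ N constantCoeff_vSeries_add_one (constantCoeff_modeSeries k)).trans
      (mul_le_mul (partialNorm_vSeries_add_one_le ih) (ih k) (apply_nonneg _ _) (by norm_num))
  have scaled : (k - 1) * partialNorm convergenceRadius (N + 1) (modeSeries k) ≤
      (k - 1) * majorant k :=
    calc (k - 1) * partialNorm convergenceRadius (N + 1) (modeSeries k)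
        = partialNorm convergenceRadius (N + 1) ((k - 1 : ℝ) • modeSeries k) := by
          rw [map_smul_eq_mul, Real.norm_of_nonneg (by linarith)]
      _ = partialNorm convergenceRadius (N + 1)
            ((k : ℝ) • ((vSeries + 1) * modeSeries k) - (k / 2 : ℝ) • squareMode k) := by
          rw [← modeSeries_rec]
          congr 1
          module
      _ ≤ k * partialNorm convergenceRadius (N + 1) ((vSeries + 1) * modeSeries k) +
            k / 2 * partialNorm convergenceRadius (N + 1) (squareMode k) := by
          refine (map_sub_le_add _ _ _).trans_eq ?_
          rw [map_smul_eq_mul, map_smul_eq_mul, Real.norm_of_nonneg (by positivity),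
            Real.norm_of_nonneg (by positivity)]
      _ ≤ k * (1 / 30 * majorant k) + k / 2 * (14 / 15 * majorant k) := by
          gcongr
          exact partialNorm_squareMode_le_majorant ih hk
      _ = k / 2 * majorant k := by ring
      _ ≤ (k - 1) * majorant k :=
          mul_le_mul_of_nonneg_right (by linarith) (majorant_nonneg k)
  exact le_of_mul_le_mul_left scaled (by linarith)

end InductionStep

theorem partialNorm_modeSeries_le (N k : ℕ) :
    partialNorm convergenceRadius N (modeSeries k) ≤ majorant k := by
  induction N generalizing k with
  | zero => rw [partialNorm_apply, range_zero, sum_empty]; exact majorant_nonneg k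
  | succ N ih => exact partialNorm_succ_modeSeries_le ih k

end Bounds

section Summability

theorem partialNorm_vSeries_le (N : ℕ) : partialNorm convergenceRadius N vSeries ≤ 31 / 30 := by
  have h := map_sub_le_add (partialNorm convergenceRadius N) (vSeries + 1) 1
  rw [add_sub_cancel_right] at h
  linarith [partialNorm_vSeries_add_one_le (partialNorm_modeSeries_le N),
    partialNorm_one_le (𝕜 := ℝ) convergenceRadius N]

/-- A weighted `ℓ¹` norm of the coefficients of `u_n`, which controls `u_n`, its derivative and its
Hilbert transform uniformly. -/
noncomputable def uNorm (n : ℕ) : ℝ := ∑ k ∈ range (n + 1), (k + 1) * |uCoeff n k|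

theorem uNorm_nonneg (n : ℕ) : 0 ≤ uNorm n := by
  unfold uNorm
  positivity

theorem summable_majorant : Summable fun k : ℕ => (k + 1 : ℝ) * majorant k := by
  have geometric : Summable fun k : ℕ => (k : ℝ) ^ 1 * (4 / 5) ^ k + (4 / 5) ^ k :=
    (summable_pow_mul_geometric_of_norm_lt_one 1 (by norm_num)).add
      (summable_geometric_of_lt_one (by norm_num) (by norm_num))
  refine geometric.of_nonneg_of_le (fun k => mul_nonneg (by positivity) (majorant_nonneg k))
    fun k => ?_
  rw [pow_one, ← add_one_mul]
  exact mul_le_mul_of_nonneg_left (majorant_le_pow k) (by positivity)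

theorem sum_uNorm_mul_pow_eq (r : ℝ≥0) (N : ℕ) : ∑ n ∈ range N, uNorm n * (r : ℝ) ^ n =
    ∑ k ∈ range N, (k + 1) * partialNorm r N (modeSeries k) := by
  simp only [partialNorm_apply, coeff_modeSeries, Real.norm_eq_abs, mul_sum]
  rw [sum_comm]
  refine sum_congr rfl fun n hn => ?_
  rw [uNorm, sum_mul]
  refine (sum_subset (range_subset_range.2 (mem_range.1 hn)) fun k _ hk => ?_).trans
    (sum_congr rfl fun k _ => by ring)
  rw [mem_range] at hk
  rw [uCoeff_eq_zero_of_lt (by omega), abs_zero, mul_zero, zero_mul]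

theorem summable_mul_pow_of_le {a : ℕ → ℝ} (ha : ∀ n, 0 ≤ a n) {r s : ℝ} (hr : 0 ≤ r)
    (hrs : r ≤ s) (h : Summable fun n => a n * s ^ n) : Summable fun n => a n * r ^ n :=
  h.of_nonneg_of_le (fun n => mul_nonneg (ha n) (by positivity))
    fun n => mul_le_mul_of_nonneg_left (by gcongr) (ha n)

theorem summable_uNorm {r : ℝ} (hr : 0 ≤ r) (hr' : r ≤ 4 / 15) :
    Summable fun n => uNorm n * r ^ n := by
  rw [← coe_convergenceRadius] at hr'
  refine summable_mul_pow_of_le uNorm_nonneg hr hr' (summable_of_sum_range_le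
    (c := ∑' k : ℕ, (k + 1 : ℝ) * majorant k)
    (fun n => mul_nonneg (uNorm_nonneg n) (by positivity)) fun N => ?_)
  calc ∑ n ∈ range N, uNorm n * (convergenceRadius : ℝ) ^ n
      = ∑ k ∈ range N, (k + 1) * partialNorm convergenceRadius N (modeSeries k) :=
        sum_uNorm_mul_pow_eq _ N
    _ ≤ ∑ k ∈ range N, (k + 1) * majorant k := by
        gcongr with k
        exact partialNorm_modeSeries_le N k
    _ ≤ ∑' k : ℕ, (k + 1 : ℝ) * majorant k :=
        summable_majorant.sum_le_tsum _ fun k _ => mul_nonneg (by positivity) (majorant_nonneg k)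

theorem summable_vCoeff {r : ℝ} (hr : 0 ≤ r) (hr' : r ≤ 4 / 15) :
    Summable fun n => |vCoeff n| * r ^ n := by
  rw [← coe_convergenceRadius] at hr'
  refine summable_mul_pow_of_le (fun n => abs_nonneg _) hr hr' (summable_of_sum_range_le
    (c := 31 / 30) (fun n => by positivity) fun N => ?_)
  convert partialNorm_vSeries_le N using 1
  rw [partialNorm_apply]
  exact sum_congr rfl fun n _ => by rw [vSeries, coeff_mk, Real.norm_eq_abs, mul_comm]

end Summability

section TrigonometricProduct

variable {N : ℕ}

theorem sum_mul_add_eq_sum_antidiagonal {R : Type*} [CommSemiring R] {a : ℕ → ℕ → R}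
    (ha : ∀ i j, N < i + j → a i j = 0) (f : ℕ → R) :
    ∑ i ∈ range (N + 1), ∑ j ∈ range (N + 1), a i j * f (i + j) =
      ∑ k ∈ range (N + 1), f k * ∑ q ∈ antidiagonal k, a q.1 q.2 := by
  have inner (k : ℕ) (hk : k ∈ range (N + 1)) : f k * ∑ q ∈ antidiagonal k, a q.1 q.2 =
      ∑ q ∈ range (N + 1) ×ˢ range (N + 1) with q.1 + q.2 = k, a q.1 q.2 * f (q.1 + q.2) := by
    rw [mul_sum]
    refine sum_congr ?_ fun q hq => by rw [(mem_filter.1 hq).2, mul_comm]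
    ext q
    simp only [mem_filter, mem_product, mem_range, mem_antidiagonal] at hk ⊢
    omega
  rw [sum_congr rfl inner, sum_fiberwise_eq_sum_filter, sum_filter_of_ne, sum_product]
  intro q _ hq
  rw [mem_range]
  by_contra h
  exact hq (by rw [ha _ _ (by omega), zero_mul])

theorem sum_mul_sub_eq_sum_shift {R : Type*} [CommRing R] {a : ℕ → ℕ → R}
    (ha : ∀ i j, N < i + j → a i j = 0) (ha_symm : ∀ i j, a i j = a j i)
    {f : ℤ → R} (hf : f.Even) (hf0 : f 0 = 0) :
    ∑ i ∈ range (N + 1), ∑ j ∈ range (N + 1), a i j * f (i - j) =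
      2 * ∑ k ∈ range (N + 1), f k * ∑ l ∈ range (N + 1), a l (k + l) := by
  have split (i j : ℕ) : a i j * f (i - j) =
      (if i ≤ j then a i j * f (j - i) else 0) + if j ≤ i then a j i * f (i - j) else 0 := by
    rcases lt_trichotomy i j with h | rfl | h
    · rw [if_pos h.le, if_neg (by omega), add_zero, ← hf, neg_sub]
    · simp [hf0]
    · rw [if_neg (by omega), if_pos h.le, zero_add, ha_symm]
  have shift (l : ℕ) : ∑ j ∈ range (N + 1), (if l ≤ j then a l j * f (j - l) else 0) =
      ∑ k ∈ range (N + 1), f k * a l (k + l) := by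
    have filter_eq : {j ∈ range (N + 1) | l ≤ j} = Ico l (N + 1) := by
      ext j
      simp only [mem_filter, mem_range, mem_Ico]
      omega
    rw [← sum_filter, filter_eq, sum_Ico_eq_sum_range]
    refine (sum_congr rfl fun k _ => ?_).trans
      (sum_subset (range_subset_range.2 (Nat.sub_le _ l)) fun k _ hk => ?_)
    · rw [add_comm l k, Nat.cast_add, add_sub_cancel_right, mul_comm]
    · rw [mem_range] at hk
      rw [ha _ _ (by omega), mul_zero]
  simp only [split, sum_add_distrib]
  rw [sum_comm (f := fun i j => if j ≤ i then a j i * f (i - j) else 0), ← two_mul]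
  simp only [shift, mul_sum]
  rw [sum_comm]

theorem two_mul_cos_mul_sin_add (a b x : ℝ) :
    2 * (Real.cos (a * x) * (b * Real.sin (b * x)) + Real.cos (b * x) * (a * Real.sin (a * x))) =
      (a + b) * Real.sin ((a + b) * x) + (a - b) * Real.sin ((a - b) * x) := by
  rw [add_mul a b x, sub_mul a b x, Real.sin_add, Real.sin_sub]
  ring

theorem sum_mul_cos_mul_sin {a : ℕ → ℕ → ℝ} (ha : ∀ i j, N < i + j → a i j = 0)
    (ha_symm : ∀ i j, a i j = a j i) (x : ℝ) :
    ∑ i ∈ range (N + 1), ∑ j ∈ range (N + 1), a i j * (Real.cos (i * x) * (j * Real.sin (j * x))) =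
      ∑ k ∈ range (N + 1), k * Real.sin (k * x) *
        (1 / 4 * ∑ q ∈ antidiagonal k, a q.1 q.2 + 1 / 2 * ∑ l ∈ range (N + 1), a l (k + l)) := by
  set S := ∑ i ∈ range (N + 1), ∑ j ∈ range (N + 1),
    a i j * (Real.cos (i * x) * (j * Real.sin (j * x))) with hS
  have swap : S = ∑ i ∈ range (N + 1), ∑ j ∈ range (N + 1),
      a i j * (Real.cos (j * x) * (i * Real.sin (i * x))) := by
    rw [hS, sum_comm]
    simp only [ha_symm]
  have sums := sum_mul_add_eq_sum_antidiagonal ha fun k => k * Real.sin (k * x)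
  have differences := sum_mul_sub_eq_sum_shift ha ha_symm (f := fun k => k * Real.sin (k * x))
    (fun k => by simp) (by simp)
  push_cast at sums differences
  have product_to_sum : 4 * S =
      (∑ i ∈ range (N + 1), ∑ j ∈ range (N + 1), a i j * ((i + j) * Real.sin ((i + j) * x))) +
      ∑ i ∈ range (N + 1), ∑ j ∈ range (N + 1), a i j * ((i - j) * Real.sin ((i - j) * x)) := by
    simp only [← sum_add_distrib, ← mul_add, ← two_mul_cos_mul_sin_add]
    calc 4 * S = 2 * (S + S) := by ring
      _ = _ := by
        nth_rw 2 [swap]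
        simp only [hS, ← sum_add_distrib, mul_sum]
        exact sum_congr rfl fun i _ => sum_congr rfl fun j _ => by ring
  rw [sums, differences] at product_to_sum
  simp only [mul_add, sum_add_distrib, mul_left_comm _ (1 / 4 : ℝ), mul_left_comm _ (1 / 2 : ℝ),
    ← mul_sum]
  linarith

end TrigonometricProduct

section FormalWaveEquation

/-- `∑_k u_{n,k} φ k`: the function `u_n` and its relatives (derivative, Hilbert transform) at a
point `x`, when `φ k` is the corresponding function of `k x`. -/
noncomputable def modeSum (φ : ℕ → ℝ) (n : ℕ) : ℝ := ∑ k ∈ range (n + 1), uCoeff n k * φ k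

theorem coeff_modeSum {m N : ℕ} (hm : m ≤ N) (φ : ℕ → ℝ) :
    coeff m (.mk (modeSum φ)) = coeff m (∑ k ∈ range (N + 1), φ k • modeSeries k) := by
  rw [coeff_mk, modeSum, map_sum]
  simp only [map_smul, coeff_modeSeries, smul_eq_mul, mul_comm (φ _)]
  refine sum_subset (range_mono (by omega)) fun k _ hk => ?_
  rw [mem_range] at hk
  rw [uCoeff_eq_zero_of_lt (by omega), zero_mul]

theorem coeff_mul_congr {R : Type*} [Semiring R] {F F' G G' : R⟦X⟧} {n : ℕ}
    (hF : ∀ m ≤ n, coeff m F = coeff m F') (hG : ∀ m ≤ n, coeff m G = coeff m G') :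
    coeff n (F * G) = coeff n (F' * G') := by
  rw [coeff_mul, coeff_mul]
  refine sum_congr rfl fun p hp => ?_
  rw [mem_antidiagonal] at hp
  rw [hF _ (by omega), hG _ (by omega)]

theorem coeff_vSeries_mul_modeSum (φ : ℕ → ℝ) (n : ℕ) :
    coeff n (vSeries * .mk (modeSum φ)) =
      ∑ k ∈ range (n + 1), φ k * coeff n (vSeries * modeSeries k) := by
  rw [coeff_mul_congr (fun _ _ => rfl) fun m hm => coeff_modeSum hm φ]
  simp only [mul_sum, mul_smul_comm, map_sum, map_smul, smul_eq_mul]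

theorem coeff_modeSum_mul_modeSum (φ ψ : ℕ → ℝ) (n : ℕ) :
    coeff n (.mk (modeSum φ) * .mk (modeSum ψ)) =
      ∑ i ∈ range (n + 1), ∑ j ∈ range (n + 1),
        coeff n (modeSeries i * modeSeries j) * (φ i * ψ j) := by
  rw [coeff_mul_congr (fun m hm => coeff_modeSum hm φ) fun m hm => coeff_modeSum hm ψ]
  simp only [sum_mul_sum, smul_mul_smul_comm, map_sum, map_smul, smul_eq_mul, mul_comm]

theorem coeff_modeSum_cos_mul_modeSum_sin (n : ℕ) (x : ℝ) :
    coeff n (.mk (modeSum fun k => Real.cos (k * x)) *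
      .mk (modeSum fun k => -(k * Real.sin (k * x)))) =
    -∑ k ∈ range (n + 1), k / 2 * Real.sin (k * x) * coeff n (squareMode k) := by
  have products := sum_mul_cos_mul_sin (N := n)
    (a := fun i j => coeff n (modeSeries i * modeSeries j))
    (fun i j h => coeff_modeSeries_mul_modeSeries_eq_zero h) (fun i j => by rw [mul_comm]) x
  simp only [coeff_modeSum_mul_modeSum, mul_neg, sum_neg_distrib]
  rw [products]
  congr 1
  refine sum_congr rfl fun k _ => ?_
  rw [squareMode, coeff_mk]
  ring

theorem formal_wave_equation (x : ℝ) :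
    .mk (modeSum fun k => Real.sin (k * x)) -
      vSeries * .mk (modeSum fun k => -(k * Real.sin (k * x))) +
      .mk (modeSum fun k => Real.cos (k * x)) * .mk (modeSum fun k => -(k * Real.sin (k * x))) =
    0 := by
  ext n
  rw [map_add, map_sub, coeff_vSeries_mul_modeSum, coeff_modeSum_cos_mul_modeSum_sin, coeff_mk,
    modeSum, ← sum_sub_distrib, ← sub_eq_add_neg, ← sum_sub_distrib, map_zero]
  refine sum_eq_zero fun k _ => ?_
  have h := congrArg (coeff n) (modeSeries_rec k)
  simp only [add_mul, one_mul, map_add, map_smul, smul_eq_mul, coeff_modeSeries] at h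
  linear_combination Real.sin (k * x) * h

end FormalWaveEquation

section Terms

/-- The Hilbert transform of `u_n`. -/
noncomputable def hTerm (n : ℕ) (x : ℝ) : ℝ := modeSum (fun k => Real.sin (k * x)) n

/-- The derivative of `u_n`. -/
noncomputable def uTermDeriv (n : ℕ) (x : ℝ) : ℝ := modeSum (fun k => -(k * Real.sin (k * x))) n

theorem abs_modeSum_le {φ : ℕ → ℝ} (hφ : ∀ k, |φ k| ≤ k + 1) (n : ℕ) :
    |modeSum φ n| ≤ uNorm n := by
  refine (abs_sum_le_sum_abs _ _).trans (sum_le_sum fun k _ => ?_)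
  rw [abs_mul, mul_comm]
  exact mul_le_mul_of_nonneg_right (hφ k) (abs_nonneg _)

theorem abs_uTerm_le (n : ℕ) (x : ℝ) : |uTerm n x| ≤ uNorm n :=
  abs_modeSum_le (fun k => (Real.abs_cos_le_one _).trans (by simp)) n

theorem abs_hTerm_le (n : ℕ) (x : ℝ) : |hTerm n x| ≤ uNorm n :=
  abs_modeSum_le (fun k => (Real.abs_sin_le_one _).trans (by simp)) n

theorem abs_uTermDeriv_le (n : ℕ) (x : ℝ) : |uTermDeriv n x| ≤ uNorm n := by
  refine abs_modeSum_le (fun k => ?_) n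
  rw [abs_neg, abs_mul, Nat.abs_cast]
  exact (mul_le_of_le_one_right k.cast_nonneg (Real.abs_sin_le_one _)).trans (by simp)

theorem continuous_uTerm (n : ℕ) : Continuous (uTerm n) := by
  unfold uTerm
  fun_prop

theorem continuous_hTerm (n : ℕ) : Continuous (hTerm n) := by
  unfold hTerm modeSum
  fun_prop

theorem continuous_uTermDeriv (n : ℕ) : Continuous (uTermDeriv n) := by
  unfold uTermDeriv modeSum
  fun_prop

theorem uTerm_periodic (n : ℕ) : Function.Periodic (uTerm n) (2 * Real.pi) := by
  intro x
  simp only [uTerm, mul_add, Real.cos_add_nat_mul_two_pi]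

theorem hasDerivAt_uTerm (n : ℕ) (x : ℝ) : HasDerivAt (uTerm n) (uTermDeriv n x) x := by
  refine HasDerivAt.fun_sum fun k _ => HasDerivAt.const_mul _ ?_
  exact ((hasDerivAt_id x).const_mul (k : ℝ)).cos.congr_deriv (by simp [mul_comm])

theorem deriv_uTerm (n : ℕ) : deriv (uTerm n) = uTermDeriv n :=
  funext fun x => (hasDerivAt_uTerm n x).deriv

theorem h1Norm_le_of_abs_le {f : ℝ → ℝ} {c : ℝ} (hf : ∀ x, |f x| ≤ c)
    (hf' : ∀ x, |deriv f x| ≤ c) : h1Norm f ≤ √(4 * Real.pi) * c := by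
  have hc : 0 ≤ c := (abs_nonneg _).trans (hf 0)
  have integral_le : ∫ x in (-Real.pi)..Real.pi, (f x ^ 2 + deriv f x ^ 2) ≤
      (c ^ 2 + c ^ 2) * |Real.pi - -Real.pi| := by
    refine (Real.le_norm_self _).trans
      (intervalIntegral.norm_integral_le_of_norm_le_const fun x _ => ?_)
    rw [Real.norm_of_nonneg (by positivity), ← sq_abs (f x), ← sq_abs (deriv f x)]
    gcongr
    exacts [hf x, hf' x]
  rw [h1Norm]
  refine Real.sqrt_le_iff.2 ⟨by positivity, integral_le.trans_eq ?_⟩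
  rw [mul_pow, Real.sq_sqrt (by positivity), sub_neg_eq_add, abs_of_pos (by positivity)]
  ring

theorem summable_h1Norm_uTerm {r : ℝ} (hr : 0 ≤ r) (hr' : r ≤ 4 / 15) :
    Summable fun n => h1Norm (uTerm n) * r ^ n := by
  refine ((summable_uNorm hr hr').mul_left √(4 * Real.pi)).of_nonneg_of_le
    (fun n => mul_nonneg (Real.sqrt_nonneg _) (by positivity)) fun n => ?_
  rw [← mul_assoc]
  gcongr
  refine h1Norm_le_of_abs_le (abs_uTerm_le n) fun x => ?_
  rw [deriv_uTerm]
  exact abs_uTermDeriv_le n x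

end Terms

section DominatedSeries

variable {α E : Type*} [MeasurableSpace α] [NormedAddCommGroup E] [CompleteSpace E]
  {μ : Measure α} [IsFiniteMeasure μ] {f : ℕ → α → E} {b : ℕ → ℝ}

theorem tendsto_eLpNorm_sum_range_sub_tsum (hb : Summable b) (hfb : ∀ n x, ‖f n x‖ ≤ b n)
    (p : ENNReal) :
    Tendsto (fun N => eLpNorm (fun x => ∑ n ∈ range N, f n x - ∑' n, f n x) p μ) atTop (𝓝 0) := by
  have tail_bound (N : ℕ) : eLpNorm (fun x => ∑ n ∈ range N, f n x - ∑' n, f n x) p μ ≤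
      μ Set.univ ^ p.toReal⁻¹ * ENNReal.ofReal (∑' n, b (n + N)) := by
    refine eLpNorm_le_of_ae_bound (ae_of_all _ fun x => ?_)
    have h := (hb.of_norm_bounded (hfb · x)).sum_add_tsum_nat_add N
    rw [← h, sub_add_cancel_left, norm_neg]
    exact tsum_of_norm_bounded ((summable_nat_add_iff N).2 hb).hasSum fun n => hfb (n + N) x
  refine tendsto_of_tendsto_of_tendsto_of_le_of_le tendsto_const_nhds ?_ (fun _ => zero_le)
    tail_bound
  have h := ENNReal.Tendsto.const_mul (a := μ Set.univ ^ p.toReal⁻¹)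
    (ENNReal.tendsto_ofReal (tendsto_sum_nat_add b))
    (Or.inr (ENNReal.rpow_ne_top_of_nonneg (by simp) (measure_ne_top _ _)))
  rwa [ENNReal.ofReal_zero, mul_zero] at h

theorem memLp_tsum_of_norm_bounded [TopologicalSpace α] [OpensMeasurableSpace α]
    [SecondCountableTopologyEither α E] (hf : ∀ n, Continuous (f n)) (hb : Summable b)
    (hfb : ∀ n x, ‖f n x‖ ≤ b n) (p : ENNReal) : MemLp (fun x => ∑' n, f n x) p μ :=
  .of_bound (continuous_tsum hf hb hfb).aestronglyMeasurable (∑' n, b n)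
    (ae_of_all _ fun x => tsum_of_norm_bounded hb.hasSum (hfb · x))

end DominatedSeries

section FourierCoefficients

theorem norm_exp_neg_I_mul_intCast_mul (k : ℤ) (x : ℝ) :
    ‖Complex.exp (-(Complex.I * k * x))‖ = 1 := by
  rw [show -(Complex.I * k * x) = ((-(k * x) : ℝ) : ℂ) * Complex.I by push_cast; ring,
    Complex.norm_exp_ofReal_mul_I]

theorem fCoeff_const_mul (c : ℂ) (f : ℝ → ℂ) (k : ℤ) :
    fCoeff (fun x => c * f x) k = c * fCoeff f k := by
  simp only [fCoeff, mul_left_comm _ c, intervalIntegral.integral_const_mul]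

theorem fCoeff_sum {ι : Type*} (s : Finset ι) {f : ι → ℝ → ℂ}
    (hf : ∀ i ∈ s, IntervalIntegrable (f i) volume (-Real.pi) Real.pi) (k : ℤ) :
    fCoeff (fun x => ∑ i ∈ s, f i x) k = ∑ i ∈ s, fCoeff (f i) k := by
  simp only [fCoeff, mul_sum]
  rw [intervalIntegral.integral_finsetSum fun i hi =>
    (hf i hi).continuousOn_mul (by fun_prop), mul_sum]

theorem fCoeff_add {f g : ℝ → ℂ} (hf : IntervalIntegrable f volume (-Real.pi) Real.pi)
    (hg : IntervalIntegrable g volume (-Real.pi) Real.pi) (k : ℤ) :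
    fCoeff (fun x => f x + g x) k = fCoeff f k + fCoeff g k := by
  simp only [fCoeff, mul_add]
  rw [intervalIntegral.integral_add (hf.continuousOn_mul (by fun_prop))
    (hg.continuousOn_mul (by fun_prop)), mul_add]

theorem hasSum_fCoeff_tsum {ι : Type*} [Countable ι] {f : ι → ℝ → ℂ} {b : ι → ℝ}
    (hf : ∀ i, Continuous (f i)) (hb : Summable b) (hfb : ∀ i x, ‖f i x‖ ≤ b i) (k : ℤ) :
    HasSum (fun i => fCoeff (f i) k) (fCoeff (fun x => ∑' i, f i x) k) := by
  refine HasSum.mul_left _ (intervalIntegral.hasSum_integral_of_dominated_convergence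
    (fun i _ => b i) (fun i => ?_) (fun i => ae_of_all _ fun x _ => ?_)
    (ae_of_all _ fun _ _ => hb) intervalIntegrable_const (ae_of_all _ fun x _ => ?_))
  · have := hf i
    exact Continuous.aestronglyMeasurable (by fun_prop)
  · rw [norm_mul, norm_exp_neg_I_mul_intCast_mul, one_mul]
    exact hfb i x
  · exact (hb.of_norm_bounded (hfb · x)).hasSum.mul_left _

theorem integral_exp_I_mul_intCast_mul (m : ℤ) :
    ∫ x in (-Real.pi)..Real.pi, Complex.exp (Complex.I * m * x) =
      if m = 0 then (2 * Real.pi : ℂ) else 0 := by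
  split_ifs with h
  · simp [h, two_mul]
  · have hm : Complex.I * m ≠ 0 := mul_ne_zero Complex.I_ne_zero (by exact_mod_cast h)
    have periodic : Complex.exp (Complex.I * m * (Real.pi : ℝ)) =
        Complex.exp (Complex.I * m * ((-Real.pi : ℝ) : ℂ)) :=
      Complex.exp_eq_exp_iff_exists_int.2 ⟨m, by push_cast; ring⟩
    rw [integral_exp_mul_complex hm, periodic, sub_self, zero_div]

theorem fCoeff_exp (m k : ℤ) :
    fCoeff (fun x => Complex.exp (Complex.I * m * x)) k = if m = k then 1 else 0 := by
  have mul_exp (x : ℝ) : Complex.exp (-(Complex.I * k * x)) * Complex.exp (Complex.I * m * x) =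
      Complex.exp (Complex.I * (m - k : ℤ) * x) := by
    rw [← Complex.exp_add]
    push_cast
    ring_nf
  simp only [fCoeff, mul_exp, integral_exp_I_mul_intCast_mul, sub_eq_zero]
  split_ifs
  · field_simp
  · rw [mul_zero]

theorem fCoeff_exp_combination (a b : ℂ) (m n k : ℤ) :
    fCoeff (fun x => a * Complex.exp (Complex.I * m * x) + b * Complex.exp (Complex.I * n * x)) k =
      a * (if m = k then 1 else 0) + b * if n = k then 1 else 0 := by
  rw [fCoeff_add, fCoeff_const_mul, fCoeff_const_mul, fCoeff_exp, fCoeff_exp] <;>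
    exact Continuous.intervalIntegrable (by fun_prop) _ _

theorem fCoeff_cos (j : ℕ) (k : ℤ) : fCoeff (fun x => (Real.cos (j * x) : ℂ)) k =
    1 / 2 * (if (j : ℤ) = k then 1 else 0) + 1 / 2 * if -(j : ℤ) = k then 1 else 0 := by
  rw [← fCoeff_exp_combination]
  congr 1 with x
  push_cast
  rw [Complex.cos]
  ring_nf

theorem fCoeff_sin (j : ℕ) (k : ℤ) : fCoeff (fun x => (Real.sin (j * x) : ℂ)) k =
    -Complex.I / 2 * (if (j : ℤ) = k then 1 else 0) +
      Complex.I / 2 * if -(j : ℤ) = k then 1 else 0 := by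
  rw [← fCoeff_exp_combination]
  congr 1 with x
  push_cast
  rw [Complex.sin]
  ring_nf

theorem fCoeff_sin_eq_sign_mul_fCoeff_cos (j : ℕ) (k : ℤ) :
    fCoeff (fun x => (Real.sin (j * x) : ℂ)) k =
      -Complex.I * (Int.sign k : ℂ) * fCoeff (fun x => (Real.cos (j * x) : ℂ)) k := by
  rw [fCoeff_sin, fCoeff_cos]
  rcases lt_trichotomy k 0 with hk | rfl | hk
  · rw [Int.sign_eq_neg_one_of_neg hk, if_neg (by omega)]
    push_cast
    ring
  · by_cases hj : j = 0 <;> simp [hj, neg_div]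
  · rw [Int.sign_eq_one_of_pos hk, if_neg (c := -(j : ℤ) = k) (by omega)]
    push_cast
    ring

theorem fCoeff_modeSum {φ : ℕ → ℝ → ℝ} (hφ : ∀ j, Continuous (φ j)) (n : ℕ) (k : ℤ) :
    fCoeff (fun x => (modeSum (φ · x) n : ℂ)) k =
      ∑ j ∈ range (n + 1), (uCoeff n j : ℂ) * fCoeff (fun x => (φ j x : ℂ)) k := by
  simp only [modeSum, Complex.ofReal_sum, Complex.ofReal_mul]
  rw [fCoeff_sum _ fun j _ => ?_]
  · simp only [fCoeff_const_mul]
  · have := hφ j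
    exact Continuous.intervalIntegrable (by fun_prop) _ _

theorem fCoeff_hTerm (n : ℕ) (k : ℤ) : fCoeff (fun x => (hTerm n x : ℂ)) k =
    -Complex.I * (Int.sign k : ℂ) * fCoeff (fun x => (uTerm n x : ℂ)) k := by
  refine (fCoeff_modeSum (φ := fun j x => Real.sin (j * x)) (fun j => by fun_prop) n k).trans ?_
  refine .trans ?_ (congrArg _
    (fCoeff_modeSum (φ := fun j x => Real.cos (j * x)) (fun j => by fun_prop) n k).symm)
  simp only [mul_sum, fCoeff_sin_eq_sign_mul_fCoeff_cos, mul_left_comm]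

end FourierCoefficients

section WaveSeries

theorem norm_ofReal_mul_pow_le {a b : ℝ} (h : |a| ≤ b) (z : ℂ) (n : ℕ) :
    ‖(a : ℂ) * z ^ n‖ ≤ b * ‖z‖ ^ n := by
  rw [norm_mul, norm_pow, Complex.norm_real]
  exact mul_le_mul_of_nonneg_right h (by positivity)

theorem continuous_ofReal_mul {f : ℝ → ℝ} (hf : Continuous f) (z : ℂ) :
    Continuous fun x => (f x : ℂ) * z := by
  fun_prop

theorem hasSum_coeff_mul {R A : Type*} [CommSemiring R] [NormedCommRing A] [CompleteSpace A]
    [Algebra R A] {F G : R⟦X⟧} {z : A} (hF : Summable fun n => ‖coeff n F • z ^ n‖)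
    (hG : Summable fun n => ‖coeff n G • z ^ n‖) :
    HasSum (fun n => coeff n (F * G) • z ^ n)
      ((∑' n, coeff n F • z ^ n) * ∑' n, coeff n G • z ^ n) := by
  have cauchy_product (n : ℕ) : coeff n (F * G) • z ^ n =
      ∑ p ∈ antidiagonal n, coeff p.1 F • z ^ p.1 * coeff p.2 G • z ^ p.2 := by
    rw [coeff_mul, sum_smul]
    refine sum_congr rfl fun p hp => ?_
    rw [smul_mul_smul_comm, ← pow_add, mem_antidiagonal.1 hp]
  rw [tsum_mul_tsum_eq_tsum_sum_antidiagonal_of_summable_norm hF hG]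
  simp only [cauchy_product]
  exact (summable_norm_sum_mul_antidiagonal_of_summable_norm hF hG).of_norm.hasSum

/-- The function `x ↦ ∑ₙ Fₙ(x) εⁿ`, for real-valued `Fₙ` and complex `ε`. -/
noncomputable def powerSum (F : ℕ → ℝ → ℝ) (ε : ℂ) (x : ℝ) : ℂ := ∑' n, (F n x : ℂ) * ε ^ n

variable {ε : ℂ} {F : ℕ → ℝ → ℝ}

theorem summable_norm_mul_pow (hε : ‖ε‖ ≤ 4 / 15) {a : ℕ → ℝ} (ha : ∀ n, |a n| ≤ uNorm n) :
    Summable fun n => ‖(a n : ℂ) * ε ^ n‖ :=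
  (summable_uNorm (norm_nonneg ε) hε).of_nonneg_of_le (fun _ => norm_nonneg _)
    fun n => norm_ofReal_mul_pow_le (ha n) ε n

theorem summable_norm_vCoeff (hε : ‖ε‖ ≤ 4 / 15) : Summable fun n => ‖(vCoeff n : ℂ) * ε ^ n‖ :=
  (summable_vCoeff (norm_nonneg ε) hε).of_nonneg_of_le (fun _ => norm_nonneg _)
    fun n => norm_ofReal_mul_pow_le le_rfl ε n

theorem continuous_powerSum (hε : ‖ε‖ ≤ 4 / 15) (hF : ∀ n, Continuous (F n))
    (hFb : ∀ n x, |F n x| ≤ uNorm n) : Continuous (powerSum F ε) :=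
  continuous_tsum (fun n => continuous_ofReal_mul (hF n) _)
    (summable_uNorm (norm_nonneg ε) hε) fun n x => norm_ofReal_mul_pow_le (hFb n x) ε n

theorem hasDerivAt_powerSum_uTerm (hε : ‖ε‖ ≤ 4 / 15) (x : ℝ) :
    HasDerivAt (powerSum uTerm ε) (powerSum uTermDeriv ε x) x :=
  hasDerivAt_tsum (summable_uNorm (norm_nonneg ε) hε)
    (fun n y => (hasDerivAt_uTerm n y).ofReal_comp.mul_const (ε ^ n))
    (fun n y => norm_ofReal_mul_pow_le (abs_uTermDeriv_le n y) ε n)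
    (summable_norm_mul_pow hε (abs_uTerm_le · 0)).of_norm x

instance : IsFiniteMeasure periodMeasure := by
  unfold periodMeasure
  infer_instance

theorem memLp_powerSum (hε : ‖ε‖ ≤ 4 / 15) (hF : ∀ n, Continuous (F n))
    (hFb : ∀ n x, |F n x| ≤ uNorm n) : MemLp (powerSum F ε) 2 periodMeasure :=
  memLp_tsum_of_norm_bounded
    (fun n => continuous_ofReal_mul (hF n) _)
    (summable_uNorm (norm_nonneg ε) hε) (fun n x => norm_ofReal_mul_pow_le (hFb n x) ε n) 2

theorem tendsto_eLpNorm_powerSum (hε : ‖ε‖ ≤ 4 / 15) (hFb : ∀ n x, |F n x| ≤ uNorm n) :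
    Tendsto (fun N => eLpNorm (fun x => ∑ n ∈ range N, (F n x : ℂ) * ε ^ n - powerSum F ε x) 2
      periodMeasure) atTop (𝓝 0) :=
  tendsto_eLpNorm_sum_range_sub_tsum (summable_uNorm (norm_nonneg ε) hε)
    (fun n x => norm_ofReal_mul_pow_le (hFb n x) ε n) 2

theorem hasSum_fCoeff_powerSum (hε : ‖ε‖ ≤ 4 / 15) (hF : ∀ n, Continuous (F n))
    (hFb : ∀ n x, |F n x| ≤ uNorm n) (k : ℤ) :
    HasSum (fun n => ε ^ n * fCoeff (fun x => (F n x : ℂ)) k) (fCoeff (powerSum F ε) k) := by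
  simp only [← fCoeff_const_mul]
  simp only [mul_comm (ε ^ _)]
  exact hasSum_fCoeff_tsum (fun n => continuous_ofReal_mul (hF n) _)
    (summable_uNorm (norm_nonneg ε) hε) (fun n x => norm_ofReal_mul_pow_le (hFb n x) ε n) k

theorem powerSum_uTerm_periodic (ε : ℂ) : Function.Periodic (powerSum uTerm ε) (2 * Real.pi) := by
  intro x
  simp only [powerSum, uTerm_periodic _ x]

theorem isH1WithDeriv_powerSum (hε : ‖ε‖ ≤ 4 / 15) :
    IsH1WithDeriv (powerSum uTerm ε) (powerSum uTermDeriv ε) where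
  periodic := powerSum_uTerm_periodic ε
  memLp := memLp_powerSum hε continuous_uTerm abs_uTerm_le
  memLp_deriv := memLp_powerSum hε continuous_uTermDeriv abs_uTermDeriv_le
  weak_deriv φ hφ hφ_periodic := by
    have boundary : powerSum uTerm ε Real.pi * φ Real.pi =
        powerSum uTerm ε (-Real.pi) * φ (-Real.pi) := by
      rw [← powerSum_uTerm_periodic ε (-_), ← hφ_periodic (-_), two_mul, neg_add_cancel_left]
    rw [intervalIntegral.integral_mul_deriv_eq_deriv_mul
      (fun x _ => hasDerivAt_powerSum_uTerm hε x)
      (fun x _ => (hφ.differentiable (by simp) x).hasDerivAt)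
      ((continuous_powerSum hε continuous_uTermDeriv abs_uTermDeriv_le).intervalIntegrable _ _)
      ((hφ.continuous_deriv (by exact_mod_cast le_top)).intervalIntegrable _ _),
      boundary, sub_self, zero_sub]

theorem convergesInH1_powerSum (hε : ‖ε‖ ≤ 4 / 15) :
    ConvergesInH1 ε (powerSum uTerm ε) (powerSum uTermDeriv ε) := by
  refine ⟨isH1WithDeriv_powerSum hε, ?_⟩
  simp only [deriv_uTerm]
  simpa only [add_zero] using (tendsto_eLpNorm_powerSum hε abs_uTerm_le).add
    (tendsto_eLpNorm_powerSum hε abs_uTermDeriv_le)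

theorem isHilbertTransform_powerSum (hε : ‖ε‖ ≤ 4 / 15) :
    IsHilbertTransform (powerSum uTerm ε) (powerSum hTerm ε) := by
  refine ⟨memLp_powerSum hε continuous_hTerm abs_hTerm_le, fun k => ?_⟩
  refine (hasSum_fCoeff_powerSum hε continuous_hTerm abs_hTerm_le k).unique ?_
  simp only [fCoeff_hTerm, mul_left_comm (ε ^ _)]
  exact (hasSum_fCoeff_powerSum hε continuous_uTerm abs_uTerm_le k).mul_left _

theorem wave_equation_powerSum (hε : ‖ε‖ ≤ 4 / 15) (x : ℝ) :
    powerSum hTerm ε x - (∑' n, (vCoeff n : ℂ) * ε ^ n) * powerSum uTermDeriv ε x +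
      powerSum uTerm ε x * powerSum uTermDeriv ε x = 0 := by
  have hh := summable_norm_mul_pow hε (abs_hTerm_le · x)
  have hu := summable_norm_mul_pow hε (abs_uTerm_le · x)
  have hw := summable_norm_mul_pow hε (abs_uTermDeriv_le · x)
  have vw := hasSum_coeff_mul (F := vSeries) (G := .mk (uTermDeriv · x)) (z := ε)
    (by simpa [vSeries] using summable_norm_vCoeff hε) (by simpa using hw)
  have uw := hasSum_coeff_mul (F := .mk (uTerm · x)) (G := .mk (uTermDeriv · x)) (z := ε)
    (by simpa using hu) (by simpa using hw)
  simp only [vSeries, coeff_mk, Complex.real_smul] at vw uw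
  refine ((hh.of_norm.hasSum.sub vw).add uw).unique ?_
  convert hasSum_zero using 2 with n
  have coefficient := congrArg (coeff n) (formal_wave_equation x)
  rw [map_add, map_sub, coeff_mk, map_zero] at coefficient
  rw [← sub_mul, ← add_mul, ← Complex.ofReal_sub, ← Complex.ofReal_add]
  exact mul_eq_zero_of_left (Complex.ofReal_eq_zero.2 coefficient) _

theorem isTravelingWave_powerSum (hε : ‖ε‖ ≤ 4 / 15) :
    IsTravelingWave (powerSum uTerm ε) (powerSum uTermDeriv ε) (∑' n, (vCoeff n : ℂ) * ε ^ n) :=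
  ⟨isH1WithDeriv_powerSum hε, powerSum hTerm ε, isHilbertTransform_powerSum hε,
    ae_of_all _ (wave_equation_powerSum hε)⟩

end WaveSeries

section RadiusBound

theorem B_lower_bound : 3.05 ≤ B := by
  refine Real.le_sqrt_of_sq_le ?_
  nlinarith [Real.pi_gt_d2]

theorem B_upper_bound : B ≤ 3.1 := by
  refine (Real.sqrt_le_left (by norm_num)).2 ?_
  nlinarith [Real.pi_lt_d2, Real.pi_pos]

theorem arsinh_le_self {y : ℝ} (hy : 0 ≤ y) : Real.arsinh y ≤ y := by
  simpa only [Real.arsinh_sinh] using Real.arsinh_le_arsinh.2 (Real.self_le_sinh_iff.2 hy)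

/-- The difference of the two sides of the inequality defining `x*`, which is thus the largest
`x ≥ 0` where it is nonpositive. -/
noncomputable def xStarDefect (x : ℝ) : ℝ :=
  8 * x + √17 * x ^ 2 - 4 + 2 * √((2 * B * x ^ 2 + 4 * x) *
    (x * √(x ^ 2 + 5 / 2) + 5 / 2 * Real.arsinh (√(2 / 5) * x)))

theorem xStar_eq_sSup : xStar = sSup {x : ℝ | 0 ≤ x ∧ xStarDefect x ≤ 0} := by
  simp only [xStar, xStarDefect, neg_mul, le_neg_iff_add_nonpos_right]

theorem monotoneOn_xStarDefect : MonotoneOn xStarDefect (Set.Ici 0) := by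
  intro x hx y _ hxy
  have hx : 0 ≤ x := hx
  have hy : 0 ≤ y := hx.trans hxy
  have hB : 0 ≤ B := Real.sqrt_nonneg _
  have arsinh_nonneg : 0 ≤ Real.arsinh (√(2 / 5) * x) := Real.arsinh_nonneg_iff.2 (by positivity)
  have arsinh_mono : Real.arsinh (√(2 / 5) * x) ≤ Real.arsinh (√(2 / 5) * y) :=
    Real.arsinh_le_arsinh.2 (by gcongr)
  unfold xStarDefect
  gcongr

theorem xStarDefect_nonpos : xStarDefect 0.226 ≤ 0 := by
  have h17 : √17 ≤ 4.13 := (Real.sqrt_le_left (by norm_num)).2 (by norm_num)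
  have hs : √(0.226 ^ 2 + 5 / 2) ≤ 1.6 := (Real.sqrt_le_left (by norm_num)).2 (by norm_num)
  have h25 : √(2 / 5) ≤ 0.64 := (Real.sqrt_le_left (by norm_num)).2 (by norm_num)
  have harsinh : Real.arsinh (√(2 / 5) * 0.226) ≤ √(2 / 5) * 0.226 :=
    arsinh_le_self (by positivity)
  have harsinh_nonneg : 0 ≤ Real.arsinh (√(2 / 5) * 0.226) :=
    Real.arsinh_nonneg_iff.2 (by positivity)
  have factor₁ : 2 * B * 0.226 ^ 2 + 4 * 0.226 ≤ 1.221 := by linarith [B_upper_bound]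
  have factor₂ : 0.226 * √(0.226 ^ 2 + 5 / 2) + 5 / 2 * Real.arsinh (√(2 / 5) * 0.226) ≤
      0.7233 := by linarith
  have hroot : √((2 * B * 0.226 ^ 2 + 4 * 0.226) *
      (0.226 * √(0.226 ^ 2 + 5 / 2) + 5 / 2 * Real.arsinh (√(2 / 5) * 0.226))) ≤ 0.99 := by
    refine (Real.sqrt_le_left (by norm_num)).2
      ((mul_le_mul factor₁ factor₂ (by positivity) (by norm_num)).trans (by norm_num))
  rw [xStarDefect]
  linarith

theorem arsinh_lower_bound : 0.137 ≤ Real.arsinh 0.1485 := by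
  have hs : 1.0109 ≤ √(1 + 0.1485 ^ 2) := Real.le_sqrt_of_sq_le (by norm_num)
  calc (0.137 : ℝ) ≤ 1 - 1.159⁻¹ := by norm_num
    _ ≤ Real.log 1.159 := Real.one_sub_inv_le_log_of_pos (by norm_num)
    _ ≤ Real.arsinh 0.1485 := Real.log_le_log (by norm_num) (by linarith)

theorem xStarDefect_pos : 0 < xStarDefect 0.2349 := by
  have h17 : 4.12 ≤ √17 := Real.le_sqrt_of_sq_le (by norm_num)
  have hs : 1.598 ≤ √(0.2349 ^ 2 + 5 / 2) := Real.le_sqrt_of_sq_le (by norm_num)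
  have h25 : 0.6324 ≤ √(2 / 5) := Real.le_sqrt_of_sq_le (by norm_num)
  have harsinh : 0.137 ≤ Real.arsinh (√(2 / 5) * 0.2349) :=
    arsinh_lower_bound.trans (Real.arsinh_le_arsinh.2 (by linarith))
  have factor₁ : 1.27 ≤ 2 * B * 0.2349 ^ 2 + 4 * 0.2349 := by linarith [B_lower_bound]
  have factor₂ : 0.71 ≤ 0.2349 * √(0.2349 ^ 2 + 5 / 2) +
      5 / 2 * Real.arsinh (√(2 / 5) * 0.2349) := by linarith
  have hroot : 0.949 ≤ √((2 * B * 0.2349 ^ 2 + 4 * 0.2349) *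
      (0.2349 * √(0.2349 ^ 2 + 5 / 2) + 5 / 2 * Real.arsinh (√(2 / 5) * 0.2349))) :=
    Real.le_sqrt_of_sq_le
      (le_trans (by norm_num) (mul_le_mul factor₁ factor₂ (by norm_num) (by linarith)))
  rw [xStarDefect]
  linarith

theorem abs_xStar_sub_lt : |xStar - 0.23| < 0.005 := by
  have upper {x : ℝ} (hx : 0 ≤ x ∧ xStarDefect x ≤ 0) : x ≤ 0.2349 := by
    by_contra! hlt
    have := monotoneOn_xStarDefect (by norm_num) hx.1 hlt.le
    linarith [hx.2, xStarDefect_pos]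
  have mem : (0.226 : ℝ) ∈ {x : ℝ | 0 ≤ x ∧ xStarDefect x ≤ 0} :=
    ⟨by norm_num, xStarDefect_nonpos⟩
  have hle : xStar ≤ 0.2349 := xStar_eq_sSup ▸ csSup_le ⟨_, mem⟩ fun _ hx => upper hx
  have hge : 0.226 ≤ xStar := xStar_eq_sSup ▸ le_csSup ⟨0.2349, fun _ hx => upper hx⟩ mem
  rw [abs_lt]
  constructor <;> linarith

end RadiusBound

end BurgersHilbert

open BurgersHilbert in
theorem mainTheorem3_general {ε : ℂ} (hε : ‖ε‖ ≤ 4 / 15) :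
    Summable (fun n : ℕ => |vCoeff n| * ‖ε‖ ^ n) ∧
    Summable (fun n : ℕ => h1Norm (uTerm n) * ‖ε‖ ^ n) ∧
    ∃ (u w : ℝ → ℂ) (v : ℂ),
      HasSum (fun n : ℕ => (vCoeff n : ℂ) * ε ^ n) v ∧
      (∀ x : ℝ, HasSum (fun n : ℕ => (uTerm n x : ℂ) * ε ^ n) (u x)) ∧
      ConvergesInH1 ε u w ∧
      IsTravelingWave u w v :=
  ⟨summable_vCoeff (norm_nonneg ε) hε, summable_h1Norm_uTerm (norm_nonneg ε) hε,
    powerSum uTerm ε, powerSum uTermDeriv ε, ∑' n, (vCoeff n : ℂ) * ε ^ n,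
    (summable_norm_vCoeff hε).of_norm.hasSum,
    fun x => (summable_norm_mul_pow hε (abs_uTerm_le · x)).of_norm.hasSum,
    convergesInH1_powerSum hε, isTravelingWave_powerSum hε⟩

open BurgersHilbert in
theorem mainTheorem3 :
    |xStar - 0.23| < 0.005 ∧
    ∀ ε : ℂ, ‖ε‖ < xStar →
      Summable (fun n : ℕ => |vCoeff n| * ‖ε‖ ^ n) ∧
      Summable (fun n : ℕ => h1Norm (uTerm n) * ‖ε‖ ^ n) ∧
      ∃ (u w : ℝ → ℂ) (v : ℂ),
        HasSum (fun n : ℕ => (vCoeff n : ℂ) * ε ^ n) v ∧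
        (∀ x : ℝ, HasSum (fun n : ℕ => (uTerm n x : ℂ) * ε ^ n) (u x)) ∧
        ConvergesInH1 ε u w ∧
        IsTravelingWave u w v :=
  ⟨abs_xStar_sub_lt, fun _ hε => mainTheorem3_general (by linarith [(abs_lt.1 abs_xStar_sub_lt).2])⟩
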